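/- Let $F$ be an algebraically closed field of characteristic zero, $G$ a finite abelian group, $n\ge 1$, and let $R=M_{n,n}(F)$ be the matrix superalgebra ($R_{\bar 0}$: block diagonal matrices, $R_{\bar 1}$: block off-diagonal matrices). Let $R=\bigoplus_{g\in G}R_g$ be a $G$-grading of the superalgebra $R$ (so $R_g=(R_g\cap R_{\bar 0})\oplus(R_g\cap R_{\bar 1})$) which is elementary: for some tuple $(t_1,\dots,t_{2n})\in G^{2n}$ and some system of matrix units $e_{ab}$ of the algebra $M_{2n}(F)$ (not assumed homogeneous for the parity), $R_g$ is spanned by the $e_{ab}$ with $t_a^{-1}t_b=g$, for every $g\in G$. Let $*$ be a superinvolution of $R$ (a parity preserving linear map with $X^{**}=X$ and $(XY)^*=(-1)^{|X||Y|}Y^*X^*$ for homogeneous $X,Y$) with $(R_g)^*=R_g$ for all $g\in G$, and suppose that $*$ is of transpose type, i.e. conjugate by an automorphism of the superalgebra $R$ to $$\begin{pmatrix}A&B\\C&D\end{pmatrix}\mapsto\begin{pmatrix}D^t&-B^t\\C^t&A^t\end{pmatrix}.$$ Then there are $r$, pairwise distinct $g_1,\dots,g_r\in G$, integers $p_k,q_k\ge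 0$ with $p_k+q_k>0$ for each $k$ and $p_1+\dots+p_r=q_1+\dots+q_r=n$, and a permutation $(i_1,\dots,i_r)$ of $(1,\dots,r)$ with $$g_1g_{i_1}=g_2g_{i_2}=\dots=g_rg_{i_r},$$ such that $R$, as a $G$-graded superalgebra with superinvolution, is isomorphic to $M_{n,n}(F)$ with the elementary grading (the matrix unit $E_{ab}$ has degree $(g'_a)^{-1}g'_b$) defined by the $2n$-tuple $$(g'_1,\dots,g'_{2n})=(g_1^{(p_1)},\dots,g_r^{(p_r)},g_{i_1}^{(q_{i_1})},\dots,g_{i_r}^{(q_{i_r})}),$$ where $g^{(k)}$ means that $g$ is repeated $k$ times, and with the superinvolution $X\mapsto\Phi^{-1}X^{\tau}\Phi$, where $$\Phi=\begin{pmatrix}0&I_n\\I_n&0\end{pmatrix},\qquad \begin{pmatrix}A&B\\C&D\end{pmatrix}^{\tau}=\begin{pmatrix}A&-B\\C&D\end{pmatrix}^{t}.$$ Moreover, under this isomorphism, the set $K(R,*)=\{X: X^*=-X\}$ corresponds to the set of all matrices $\begin{pmatrix}A&B\\C&-A^t\end{pmatrix}$ with $A$ any $n\times n$ matrix, $B$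 symmetric and $C$ skew-symmetric of order $n$, and the set $H(R,*)=\{X: X^*=X\}$ corresponds to the set of all matrices $\begin{pmatrix}A&B\\C&A^t\end{pmatrix}$ with $A$ any $n\times n$ matrix, $B$ skew-symmetric and $C$ symmetric of order $n$. -/

import Mathlib

open Matrix

/-- The associative algebra underlying the matrix superalgebra `M_{n,m}(F)`: square matrices of
order `n + m`, whose rows and columns are indexed by `n` even and `m` odd indices. -/
abbrev SuperMat (n m : ℕ) (F : Type*) := Matrix (Fin n ⊕ Fin m) (Fin n ⊕ Fin m) F

/-- The even (`k = 0`) and the odd (`k = 1`) component of the superalgebra `M_{n,m}(F)`: block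
diagonal, respectively block off-diagonal matrices. -/
def superComp (n m : ℕ) (F : Type*) [Field F] (k : ZMod 2) : Submodule F (SuperMat n m F) where
  carrier := {X | if k = 0 then X.toBlocks₁₂ = 0 ∧ X.toBlocks₂₁ = 0
    else X.toBlocks₁₁ = 0 ∧ X.toBlocks₂₂ = 0}
  zero_mem' := by
    show ite _ _ _
    split_ifs <;> exact ⟨rfl, rfl⟩
  add_mem' := by
    intro X Y hX hY
    simp only [Set.mem_ofPred_eq] at hX hY ⊢
    split_ifs at hX hY ⊢
    all_goals
      constructor
      · ext i j
        simpa [toBlocks₁₁, toBlocks₁₂] using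
          congrArg₂ (· + ·) (congrFun (congrFun hX.1 i) j) (congrFun (congrFun hY.1 i) j)
      · ext i j
        simpa [toBlocks₂₁, toBlocks₂₂] using
          congrArg₂ (· + ·) (congrFun (congrFun hX.2 i) j) (congrFun (congrFun hY.2 i) j)
  smul_mem' := by
    intro c X hX
    simp only [Set.mem_ofPred_eq] at hX ⊢
    split_ifs at hX ⊢
    all_goals
      constructor
      · ext i j
        simpa [toBlocks₁₁, toBlocks₁₂] using
          congrArg (c * ·) (congrFun (congrFun hX.1 i) j)
      · ext i j
        simpa [toBlocks₂₁, toBlocks₂₂] using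
          congrArg (c * ·) (congrFun (congrFun hX.2 i) j)

/-- A superinvolution on the superalgebra `M_{n,m}(F)`: a parity preserving linear map whose square
is the identity and which satisfies `(ab)* = (-1)^{|a||b|} b* a*` for homogeneous `a`, `b`. -/
structure IsSuperinvolution {n m : ℕ} {F : Type*} [Field F]
    (s : SuperMat n m F →ₗ[F] SuperMat n m F) : Prop where
  map_mem : ∀ (k : ZMod 2) (a : SuperMat n m F), a ∈ superComp n m F k → s a ∈ superComp n m F k
  involutive : ∀ a : SuperMat n m F, s (s a) = a
  map_mul : ∀ (k l : ZMod 2) (a b : SuperMat n m F),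
    a ∈ superComp n m F k → b ∈ superComp n m F l →
      s (a * b) = (-1 : F) ^ (k.val * l.val) • (s b * s a)

/-- An algebra automorphism of `M_{n,m}(F)` is a superalgebra automorphism if it maps each of the
two parity components onto itself. -/
def IsSuperAut {n m : ℕ} {F : Type*} [Field F] (φ : SuperMat n m F ≃ₐ[F] SuperMat n m F) : Prop :=
  ∀ k : ZMod 2, (superComp n m F k).map φ.toLinearMap = superComp n m F k

/-- The standard transpose superinvolution of `M_{n,n}(F)`, in block form. -/
def trp {n : ℕ} {F : Type*} [Field F] (X : SuperMat n n F) : SuperMat n n F :=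
  fromBlocks X.toBlocks₂₂ᵀ (-X.toBlocks₁₂ᵀ) X.toBlocks₂₁ᵀ X.toBlocks₁₁ᵀ

/-- A map `s` on `M_{n,n}(F)` is of transpose type if it is conjugate, by an automorphism of the
superalgebra, to the standard transpose superinvolution. -/
def IsTransposeType {n : ℕ} {F : Type*} [Field F]
    (s : SuperMat n n F →ₗ[F] SuperMat n n F) : Prop :=
  ∃ ψ : SuperMat n n F ≃ₐ[F] SuperMat n n F, IsSuperAut ψ ∧ ∀ X, ψ (s X) = trp (ψ X)

/-- The map `X ↦ X^τ`: the sign of the upper right block is changed, then one transposes. -/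
def superTau {n m : ℕ} {F : Type*} [Field F] (X : SuperMat n m F) : SuperMat n m F :=
  (fromBlocks X.toBlocks₁₁ (-X.toBlocks₁₂) X.toBlocks₂₁ X.toBlocks₂₂)ᵀ

/-- The matrix `Φ` with blocks `0, I` in the first and `I, 0` in the second block row. -/
def swapPhi (n : ℕ) (F : Type*) [Field F] : SuperMat n n F := fromBlocks 0 1 1 0

/-- `R = ⨁ R_g` is a grading of the superalgebra `R = M_{n,m}(F)` by the group `G`: the sum is
direct, `R_g R_h ⊆ R_{gh}`, and each `R_g` is the sum of its even and its odd part. -/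
structure IsSuperGrading {n m : ℕ} {F G : Type*} [Field F] [CommGroup G]
    (R : G → Submodule F (SuperMat n m F)) : Prop where
  indep : iSupIndep R
  iSup_eq_top : ⨆ g, R g = ⊤
  mul_mem : ∀ (g h : G) (a b : SuperMat n m F), a ∈ R g → b ∈ R h → a * b ∈ R (g * h)
  parity : ∀ g, R g = (R g ⊓ superComp n m F 0) ⊔ (R g ⊓ superComp n m F 1)

/-- The component of degree `g` of the elementary grading given by the tuple `t`: the span of the
matrix units `E_{ij}` with `t_i⁻¹ t_j = g`. -/
def elementaryComp {n m : ℕ} (F : Type*) {G : Type*} [Field F] [CommGroup G]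
    (t : Fin n ⊕ Fin m → G) (g : G) : Submodule F (SuperMat n m F) :=
  Submodule.span F {X | ∃ i j, (t i)⁻¹ * t j = g ∧ X = Matrix.single i j 1}

/-- A grading is elementary if, for some tuple `t` and some system of matrix units of the full
matrix algebra (the images of the standard ones under an algebra automorphism, which need not
respect parity), the component of each degree `g` is spanned by the units with
`t_i⁻¹ t_j = g`. -/
def IsElementary {n m : ℕ} {F G : Type*} [Field F] [CommGroup G]
    (R : G → Submodule F (SuperMat n m F)) : Prop :=
  ∃ (t : Fin n ⊕ Fin m → G) (ψ : SuperMat n m F ≃ₐ[F] SuperMat n m F),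
    ∀ g, R g = (elementaryComp F t g).map ψ.toLinearMap

/-- A superinvolution respects a grading (is graded) if it maps each component onto itself. -/
def RespectsGrading {n m : ℕ} {F G : Type*} [Field F] [CommGroup G]
    (s : SuperMat n m F →ₗ[F] SuperMat n m F) (R : G → Submodule F (SuperMat n m F)) : Prop :=
  ∀ g, (R g).map s = R g

/-- The `n`-tuple `u` is `(g_1^{(p_1)}, …, g_r^{(p_r)})`, that is, `g_1` repeated `p_1` times,
followed by `g_2` repeated `p_2` times, and so on. -/
def IsBlockTuple {n r : ℕ} {G : Type*} (u : Fin n → G) (g : Fin r → G) (p : Fin r → ℕ) : Prop :=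
  List.ofFn u = (List.ofFn fun k => List.replicate (p k) (g k)).flatten

/-- `K(R, *)`: the elements skew-symmetric under the superinvolution `s`. -/
def skewElements {n m : ℕ} {F : Type*} [Field F]
    (s : SuperMat n m F →ₗ[F] SuperMat n m F) : Set (SuperMat n m F) := {X | s X = -X}

/-- `H(R, *)`: the elements fixed by the superinvolution `s`. -/
def symmElements {n m : ℕ} {F : Type*} [Field F]
    (s : SuperMat n m F →ₗ[F] SuperMat n m F) : Set (SuperMat n m F) := {X | s X = X}

/-! The characters of `G` turn the grading into a family of commuting automorphisms. Transport by
the automorphism that makes `*` equal to `trp`; the grading stays elementary. Each character χ then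
acts as conjugation by an invertible matrix T_χ, the image of diag(χ(t_a)), and since parity and
`trp` preserve the components, both commute with this conjugation.

By centrality of the scalars, T_χ is even or odd (`parityAut_eq_or_eq_neg`). The odd case
contradicts `trp` (`false_of_odd`); in the even case T_χ = diag(A_χ, D_χ) with D_χᵀ A_χ = λ(χ)
scalar (`exists_trp_mul_eq_smul_of_even`).

The A_χ are simultaneously diagonalizable with eigenvalues χ(h_k), where the h_k are entries of t. A
change of basis diag(V, Uᵀ) with V = U⁻¹ diagonalizes them and commutes with `trp`, so D_χ becomes
diag(λ(χ) χ(h_k)⁻¹). As these are again eigenvalues of T_χ, λ(χ) = χ(g₀) for some g₀ in `G`: the odd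
degrees are g₀ h_k⁻¹ (`exists_adapted_automorphism`).

Characters separate points, so the grading can be read off from the T_χ (`map_elementaryComp`).
Sorting the h_k and letting x ↦ g₀ x⁻¹ permute the degrees gives the tuple (`exists_isBlockTuple`).
-/

namespace Matrix

/-! ### Linear algebra and automorphisms of matrix algebras -/

/-- From the columns of a matrix with a right inverse one can select an invertible square matrix. -/
theorem exists_isUnit_submatrix_of_mul_eq_one {F ι : Type*} [Field F] [Fintype ι] {n : ℕ}
    {M : Matrix (Fin n) ι F} {N : Matrix ι (Fin n) F} (h : M * N = 1) :
    ∃ c : Fin n → ι, IsUnit (M.submatrix id c) := by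
  classical
  have hspan : Submodule.span F (Set.range M.col) = ⊤ := by
    rw [eq_top_iff]
    rintro v -
    have hv : v = ∑ j, (N *ᵥ v) j • M.col j := by
      have : M *ᵥ (N *ᵥ v) = v := by rw [mulVec_mulVec, h, one_mulVec]
      conv_lhs => rw [← this]
      rw [mulVec_eq_sum]
      simp [Matrix.col, Matrix.transpose]
    rw [hv]
    exact Submodule.sum_mem _ fun j _ =>
      Submodule.smul_mem _ _ (Submodule.subset_span ⟨j, rfl⟩)
  -- An independent set of columns with the same span is a basis of Fⁿ, so it has exactly n
  -- elements.
  obtain ⟨b, hb, hbs, hli⟩ := exists_linearIndependent F (Set.range M.col)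
  let B : Module.Basis b F (Fin n → F) := Module.Basis.mk hli (by simp [hbs, hspan])
  have : Fintype b := Module.Basis.fintypeIndexOfRankLtAleph0 B (Module.rank_lt_aleph0 F _)
  have hcard : Fintype.card b = n := by
    rw [← Module.finrank_eq_card_basis B, Module.finrank_fin_fun]
  let e : Fin n ≃ b := (Fintype.equivFinOfCardEq hcard).symm
  choose c hc using fun x : b => hb x.2
  refine ⟨fun k => c (e k), linearIndependent_cols_iff_isUnit.1 ?_⟩
  have : (M.submatrix id fun k => c (e k)).col = (fun x : b => (x : Fin n → F)) ∘ e := by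
    ext k i
    exact congrFun (hc (e k)) i
  rw [this]
  exact hli.comp e e.injective

/-- The algebra automorphisms of a matrix algebra over a field are inner. -/
theorem exists_conj_of_algEquiv {F ι : Type*} [Field F] [Fintype ι] [DecidableEq ι]
    (f : Matrix ι ι F ≃ₐ[F] Matrix ι ι F) :
    ∃ Q Q' : Matrix ι ι F, Q * Q' = 1 ∧ Q' * Q = 1 ∧ ∀ X, f X = Q * X * Q' := by
  obtain ⟨T, hT⟩ := AlgEquiv.eq_linearEquivConjAlgEquiv
    ((toLinAlgEquiv'.symm.trans f).trans (toLinAlgEquiv' (R := F) (n := ι)))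
  have key : ∀ X, toLin' (f X) = T.toLinearMap ∘ₗ toLin' X ∘ₗ T.symm.toLinearMap := fun X => by
    have := DFunLike.congr_fun hT (toLin' X)
    rw [LinearEquiv.conjAlgEquiv_apply] at this
    rw [← this]
    change _ = toLin' (f (LinearMap.toMatrix' (toLin' X)))
    rw [LinearMap.toMatrix'_toLin']
  refine ⟨LinearMap.toMatrix' T.toLinearMap, LinearMap.toMatrix' T.symm.toLinearMap, ?_, ?_, ?_⟩
  · rw [← LinearMap.toMatrix'_comp]; simp
  · rw [← LinearMap.toMatrix'_comp]; simp
  · intro X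
    apply toLin'.injective
    rw [key, toLin'_mul, toLin'_mul]
    simp [LinearMap.comp_assoc]

/-- A matrix commuting with all matrices is scalar. -/
theorem exists_eq_smul_one_of_forall_commute {F ι : Type*} [Field F] [Fintype ι] [DecidableEq ι]
    {M : Matrix ι ι F} (h : ∀ X, M * X = X * M) : ∃ c : F, M = c • 1 := by
  obtain ⟨c, hc⟩ := mem_range_scalar_of_commute_single (M := M) fun i j _ => (h _).symm
  exact ⟨c, by rw [← hc, smul_one_eq_diagonal]; rfl⟩

/-- Conjugation by an invertible matrix. -/
def conjEquiv {F ι : Type*} [Field F] [Fintype ι] [DecidableEq ι] (P P' : Matrix ι ι F)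
    (h : P * P' = 1) (h' : P' * P = 1) : Matrix ι ι F ≃ₐ[F] Matrix ι ι F :=
  AlgEquiv.ofAlgHom
    { toFun := fun X => P * X * P'
      map_one' := by simp [h]
      map_mul' := fun X Y => by
        rw [show P * X * P' * (P * Y * P') = P * X * (P' * P) * Y * P' by
          simp only [Matrix.mul_assoc], h']
        simp only [Matrix.mul_assoc, Matrix.one_mul]
      map_zero' := by simp
      map_add' := fun X Y => by simp [Matrix.mul_add, Matrix.add_mul]
      commutes' := fun r => by simp [Algebra.algebraMap_eq_smul_one, h] }
    { toFun := fun X => P' * X * P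
      map_one' := by simp [h']
      map_mul' := fun X Y => by
        rw [show P' * X * P * (P' * Y * P) = P' * X * (P * P') * Y * P by
          simp only [Matrix.mul_assoc], h]
        simp only [Matrix.mul_assoc, Matrix.one_mul]
      map_zero' := by simp
      map_add' := fun X Y => by simp [Matrix.mul_add, Matrix.add_mul]
      commutes' := fun r => by simp [Algebra.algebraMap_eq_smul_one, h'] }
    (by
      ext1 X
      change P * (P' * X * P) * P' = X
      rw [show P * (P' * X * P) * P' = (P * P') * X * (P * P') by
        simp only [Matrix.mul_assoc], h, Matrix.one_mul, Matrix.mul_one])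
    (by
      ext1 X
      change P' * (P * X * P') * P = X
      rw [show P' * (P * X * P') * P = (P' * P) * X * (P' * P) by
        simp only [Matrix.mul_assoc], h', Matrix.one_mul, Matrix.mul_one])

theorem conjEquiv_apply {F ι : Type*} [Field F] [Fintype ι] [DecidableEq ι] (P P' : Matrix ι ι F)
    (h : P * P' = 1) (h' : P' * P = 1) (X : Matrix ι ι F) :
    conjEquiv P P' h h' X = P * X * P' := rfl

end Matrix

/-- The characters of a finite commutative group with values in an algebraically closed field of
characteristic zero separate the elements of the group. -/
theorem eq_of_forall_character_eq (F : Type*) {G : Type*} [Field F] [IsAlgClosed F] [CharZero F]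
    [CommGroup G] [Finite G] {a b : G} (h : ∀ χ : G →* Fˣ, (χ a : F) = χ b) : a = b := by
  by_contra hab
  have : NeZero (Monoid.exponent G : F) :=
    ⟨Nat.cast_ne_zero.2 (Monoid.ExponentExists.of_finite (G := G)).exponent_ne_zero⟩
  obtain ⟨χ, hχ⟩ := CommGroup.exists_apply_ne_one_of_hasEnoughRootsOfUnity G F
    (a := a * b⁻¹) (by rwa [Ne, mul_inv_eq_one])
  exact hχ (by rw [map_mul, map_inv, Units.ext (h χ), mul_inv_cancel])

/-! ### Sorted tuples as blocks of repeated entries -/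

section BlockTuple

/-- A monotone tuple of indices consists of consecutive blocks of equal entries. -/
theorem List.ofFn_eq_flatten_of_monotone {n r : ℕ} {f : Fin n → Fin r} (hf : Monotone f) :
    List.ofFn f = (List.ofFn fun k => List.replicate (Finset.univ.filter (f · = k)).card k).flatten := by
  -- Both lists are sorted, so it suffices that each index occurs equally often in them.
  apply List.Perm.eq_of_pairwise' (r := (· ≤ ·))
  · rw [List.pairwise_ofFn]
    exact fun i j hij => hf hij.le
  · rw [List.pairwise_flatten]
    refine ⟨?_, ?_⟩
    · intro l hl
      rw [List.mem_ofFn] at hl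
      obtain ⟨k, rfl⟩ := hl
      exact List.pairwise_replicate.2 (Or.inr le_rfl)
    · rw [List.pairwise_ofFn]
      intro i j hij a ha b hb
      rw [List.eq_of_mem_replicate ha, List.eq_of_mem_replicate hb]
      exact hij.le
  · rw [List.perm_iff_count]
    intro a
    rw [List.count_flatten, List.map_ofFn, List.sum_ofFn]
    simp only [Function.comp_def, List.count_replicate, beq_iff_eq]
    rw [Finset.sum_ite_eq' Finset.univ a]
    rw [List.ofFn_eq_map, List.count_eq_countP, List.countP_map, List.countP_eq_length_filter,
      if_pos (Finset.mem_univ a)]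
    change _ = ((List.finRange n).filter fun x => f x = a).length
    exact congrArg List.length (List.filter_congr fun x _ => Bool.eq_iff_iff.2 (by simp))

/-- The multiplicities depend only on `f`. Hence the even and the odd half of the tuple, which use
the same `f` with different `g`, have the same block lengths. -/
theorem isBlockTuple_comp {n r : ℕ} {G : Type*} {f : Fin n → Fin r} (hf : Monotone f)
    (g : Fin r → G) :
    IsBlockTuple (fun a => g (f a)) g fun k => (Finset.univ.filter (f · = k)).card := by
  have := congrArg (List.map g) (List.ofFn_eq_flatten_of_monotone hf)
  rw [List.map_ofFn, List.map_flatten, List.map_ofFn] at this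
  simpa [IsBlockTuple, Function.comp_def] using this

end BlockTuple

/-! ### Elementary gradings as eigenspaces of the characters -/

section Characters

variable {F G : Type*} [Field F] [CommGroup G]

/-- The diagonal matrix of the values of a character on a tuple of group elements. -/
def charDiag {ι : Type*} [DecidableEq ι] (χ : G →* Fˣ) (t : ι → G) : Matrix ι ι F :=
  diagonal fun i => (χ (t i) : F)

theorem charDiag_mul_inv {ι : Type*} [Fintype ι] [DecidableEq ι] (χ : G →* Fˣ) (t : ι → G) :
    charDiag χ t * charDiag χ⁻¹ t = 1 := by
  simp [charDiag]

theorem charDiag_inv_mul {ι : Type*} [Fintype ι] [DecidableEq ι] (χ : G →* Fˣ) (t : ι → G) :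
    charDiag χ⁻¹ t * charDiag χ t = 1 := by
  simp [charDiag]

theorem mem_elementaryComp_iff_apply {n m : ℕ} {t : Fin n ⊕ Fin m → G} {g : G}
    {X : SuperMat n m F} :
    X ∈ elementaryComp F t g ↔ ∀ i j, X i j ≠ 0 → (t i)⁻¹ * t j = g := by
  classical
  constructor
  · intro hX
    induction hX using Submodule.span_induction with
    | mem X h =>
      obtain ⟨a, b, hab, rfl⟩ := h
      intro i j hij
      rw [Matrix.single_apply] at hij
      split_ifs at hij with h
      · rw [← h.1, ← h.2, hab]
      · exact absurd rfl hij
    | zero => intro i j h; exact absurd rfl h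
    | add X Y _ _ hX hY =>
      intro i j h
      by_cases hx : X i j = 0
      · exact hY i j fun hy => h (by simp [hx, hy])
      · exact hX i j hx
    | smul c X _ hX =>
      intro i j h
      exact hX i j fun hx => h (by simp [hx])
  · intro h
    rw [matrix_eq_sum_single X]
    refine Submodule.sum_mem _ fun i _ => Submodule.sum_mem _ fun j _ => ?_
    by_cases hx : X i j = 0
    · simp [hx]
    · have : single i j (X i j) = X i j • (single i j 1 : SuperMat n m F) := by
        simp
      rw [this]
      exact Submodule.smul_mem _ _ (Submodule.subset_span ⟨i, j, h i j hx, rfl⟩)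

theorem charDiag_conj_apply {ι : Type*} [Fintype ι] [DecidableEq ι] (χ : G →* Fˣ) (t : ι → G)
    (X : Matrix ι ι F) (i j : ι) :
    (charDiag χ t * X * charDiag χ⁻¹ t) i j = (χ ((t i)⁻¹ * t j)⁻¹ : F) * X i j := by
  simp [charDiag]
  ring

theorem charDiag_conj_of_mem {n m : ℕ} {t : Fin n ⊕ Fin m → G} {g : G} {X : SuperMat n m F}
    (hX : X ∈ elementaryComp F t g) (χ : G →* Fˣ) :
    charDiag χ t * X * charDiag χ⁻¹ t = (χ g⁻¹ : F) • X := by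
  ext i j
  rw [charDiag_conj_apply, Matrix.smul_apply, smul_eq_mul]
  by_cases hx : X i j = 0
  · simp [hx]
  · rw [mem_elementaryComp_iff_apply.1 hX i j hx]

/-- At a nonzero entry (i, j) the eigenvalue equations say that every χ agrees on t_i⁻¹ t_j and g,
and characters separate points. A component is thus a joint eigenspace. -/
theorem mem_elementaryComp_iff [IsAlgClosed F] [CharZero F] [Finite G] {n m : ℕ}
    {t : Fin n ⊕ Fin m → G} {g : G} {X : SuperMat n m F} :
    X ∈ elementaryComp F t g ↔
      ∀ χ : G →* Fˣ, charDiag χ t * X * charDiag χ⁻¹ t = (χ g⁻¹ : F) • X := by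
  refine ⟨fun hX => charDiag_conj_of_mem hX, fun h => mem_elementaryComp_iff_apply.2 ?_⟩
  intro i j hx
  refine inv_injective (eq_of_forall_character_eq F fun χ => ?_)
  have := congrFun (congrFun (h χ) i) j
  rw [charDiag_conj_apply, Matrix.smul_apply, smul_eq_mul] at this
  exact mul_right_cancel₀ hx this

/-- An automorphism of the matrix algebra matching the character actions matches the elementary
gradings. -/
theorem map_elementaryComp [IsAlgClosed F] [CharZero F] [Finite G] {n m : ℕ}
    {t t' : Fin n ⊕ Fin m → G} (ω : SuperMat n m F ≃ₐ[F] SuperMat n m F)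
    (h : ∀ χ : G →* Fˣ, ω (charDiag χ t) = charDiag χ t') (g : G) :
    (elementaryComp F t g).map ω.toLinearMap = elementaryComp F t' g := by
  have key : ∀ X, X ∈ elementaryComp F t g ↔ ω X ∈ elementaryComp F t' g := fun X => by
    rw [mem_elementaryComp_iff, mem_elementaryComp_iff]
    refine forall_congr' fun χ => ?_
    rw [← h, ← h, ← map_mul, ← map_mul, ← map_smul, ω.injective.eq_iff]
  ext Y
  constructor
  · rintro ⟨X, hX, rfl⟩
    exact (key X).1 hX
  · intro hY
    exact ⟨ω.symm Y, (key _).2 (by simpa using hY), by simp⟩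

/-- A linear map preserving the components of an elementary grading commutes with the action of
the characters. -/
theorem map_char_conj {n m : ℕ} {t : Fin n ⊕ Fin m → G}
    (ω : SuperMat n m F ≃ₐ[F] SuperMat n m F) (L : SuperMat n m F →ₗ[F] SuperMat n m F)
    (hL : ∀ g, ∀ X ∈ (elementaryComp F t g).map ω.toLinearMap,
      L X ∈ (elementaryComp F t g).map ω.toLinearMap) (χ : G →* Fˣ) (X : SuperMat n m F) :
    L (ω (charDiag χ t) * X * ω (charDiag χ⁻¹ t)) =
      ω (charDiag χ t) * L X * ω (charDiag χ⁻¹ t) := by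
  have hom : ∀ g, ∀ X ∈ (elementaryComp F t g).map ω.toLinearMap,
      ω (charDiag χ t) * X * ω (charDiag χ⁻¹ t) = (χ g⁻¹ : F) • X := by
    rintro g _ ⟨Y, hY, rfl⟩
    change ω _ * ω Y * ω _ = _ • ω Y
    rw [← map_mul, ← map_mul, charDiag_conj_of_mem hY, map_smul]
  obtain ⟨Y, rfl⟩ := ω.surjective X
  -- By linearity it is enough to treat matrix units. These are homogeneous, and on each component
  -- the conjugation is a scalar.
  induction Y using Matrix.induction_on' with
  | h_zero => simp
  | h_add Y Z hY hZ => simp only [map_add, Matrix.mul_add, Matrix.add_mul, hY, hZ]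
  | h_std_basis i j c =>
    have hmem : ω (single i j c) ∈ (elementaryComp F t ((t i)⁻¹ * t j)).map ω.toLinearMap := by
      refine ⟨_, mem_elementaryComp_iff_apply.2 fun a b hab => ?_, rfl⟩
      rw [Matrix.single_apply] at hab
      split_ifs at hab with h
      · rw [h.1, h.2]
      · exact absurd rfl hab
    rw [hom _ _ hmem, hom _ _ (hL _ _ hmem), map_smul]

end Characters

/-! ### The parity automorphism -/

section Parity

variable {F : Type*} [Field F] {n m : ℕ}

/-- The parity automorphism of `M_{n,m}(F)`: the identity on even and `-1` on odd matrices. -/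
def parityAut (n m : ℕ) (F : Type*) [Field F] : SuperMat n m F ≃ₐ[F] SuperMat n m F :=
  conjEquiv (fromBlocks 1 0 0 (-1)) (fromBlocks 1 0 0 (-1)) (by simp [fromBlocks_multiply])
    (by simp [fromBlocks_multiply])

@[simp]
theorem parityAut_fromBlocks (A : Matrix (Fin n) (Fin n) F) (B : Matrix (Fin n) (Fin m) F)
    (C : Matrix (Fin m) (Fin n) F) (D : Matrix (Fin m) (Fin m) F) :
    parityAut n m F (fromBlocks A B C D) = fromBlocks A (-B) (-C) D := by
  simp [parityAut, conjEquiv_apply, fromBlocks_multiply]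

@[simp]
theorem parityAut_parityAut (X : SuperMat n m F) : parityAut n m F (parityAut n m F X) = X := by
  rw [← fromBlocks_toBlocks X]
  simp

theorem mem_superComp_zero {X : SuperMat n m F} :
    X ∈ superComp n m F 0 ↔ X.toBlocks₁₂ = 0 ∧ X.toBlocks₂₁ = 0 := by
  change (if (0 : ZMod 2) = 0 then X.toBlocks₁₂ = 0 ∧ X.toBlocks₂₁ = 0
    else X.toBlocks₁₁ = 0 ∧ X.toBlocks₂₂ = 0) ↔ _
  rw [if_pos rfl]

theorem mem_superComp_one {X : SuperMat n m F} :
    X ∈ superComp n m F 1 ↔ X.toBlocks₁₁ = 0 ∧ X.toBlocks₂₂ = 0 := by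
  change (if (1 : ZMod 2) = 0 then X.toBlocks₁₂ = 0 ∧ X.toBlocks₂₁ = 0
    else X.toBlocks₁₁ = 0 ∧ X.toBlocks₂₂ = 0) ↔ _
  rw [if_neg (by decide)]

theorem Matrix.eq_zero_of_neg_eq_self [CharZero F] {ι κ : Type*} {B : Matrix ι κ F} (h : -B = B) : B = 0 := by
  ext i j
  exact self_eq_neg.1 (congrFun (congrFun h i) j).symm

theorem parityAut_eq_self_iff [CharZero F] {X : SuperMat n m F} :
    parityAut n m F X = X ↔ X ∈ superComp n m F 0 := by
  rw [mem_superComp_zero]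
  conv_lhs => rw [← fromBlocks_toBlocks X]
  rw [parityAut_fromBlocks, fromBlocks_inj]
  constructor
  · exact fun h => ⟨Matrix.eq_zero_of_neg_eq_self h.2.1, Matrix.eq_zero_of_neg_eq_self h.2.2.1⟩
  · rintro ⟨h, h'⟩
    simp [h, h']

theorem parityAut_eq_neg_iff [CharZero F] {X : SuperMat n m F} :
    parityAut n m F X = -X ↔ X ∈ superComp n m F 1 := by
  rw [mem_superComp_one]
  conv_lhs => rw [← fromBlocks_toBlocks X]
  rw [parityAut_fromBlocks, fromBlocks_neg, fromBlocks_inj]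
  constructor
  · exact fun h => ⟨Matrix.eq_zero_of_neg_eq_self h.1.symm, Matrix.eq_zero_of_neg_eq_self h.2.2.2.symm⟩
  · rintro ⟨h, h'⟩
    simp [h, h']

theorem exists_superComp_add (X : SuperMat n m F) :
    ∃ Y ∈ superComp n m F 0, ∃ Z ∈ superComp n m F 1, X = Y + Z := by
  refine ⟨fromBlocks X.toBlocks₁₁ 0 0 X.toBlocks₂₂, mem_superComp_zero.2 (by simp),
    fromBlocks 0 X.toBlocks₁₂ X.toBlocks₂₁ 0, mem_superComp_one.2 (by simp), ?_⟩
  conv_lhs => rw [← fromBlocks_toBlocks X]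
  simp [fromBlocks_add]

/-- The parity components are the ±1 eigenspaces of `parityAut`. Together with the converse below,
this replaces preservation of both components by a single commutation relation. -/
theorem IsSuperAut.apply_parityAut [CharZero F] {φ : SuperMat n m F ≃ₐ[F] SuperMat n m F}
    (h : IsSuperAut φ) (X : SuperMat n m F) : φ (parityAut n m F X) = parityAut n m F (φ X) := by
  obtain ⟨Y, hY, Z, hZ, rfl⟩ := exists_superComp_add X
  have hY' : φ Y ∈ superComp n m F 0 := h 0 ▸ ⟨Y, hY, rfl⟩
  have hZ' : φ Z ∈ superComp n m F 1 := h 1 ▸ ⟨Z, hZ, rfl⟩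
  simp only [map_add, parityAut_eq_self_iff.2 hY, parityAut_eq_neg_iff.2 hZ,
    parityAut_eq_self_iff.2 hY', parityAut_eq_neg_iff.2 hZ', map_neg]

theorem isSuperAut_of_apply_parityAut [CharZero F] {φ : SuperMat n m F ≃ₐ[F] SuperMat n m F}
    (h : ∀ X, φ (parityAut n m F X) = parityAut n m F (φ X)) : IsSuperAut φ := by
  have key : ∀ (k : ZMod 2) (X : SuperMat n m F),
      X ∈ superComp n m F k ↔ φ X ∈ superComp n m F k := by
    intro k X
    fin_cases k
    · change X ∈ superComp n m F 0 ↔ φ X ∈ superComp n m F 0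
      rw [← parityAut_eq_self_iff, ← parityAut_eq_self_iff, ← h, φ.injective.eq_iff]
    · change X ∈ superComp n m F 1 ↔ φ X ∈ superComp n m F 1
      rw [← parityAut_eq_neg_iff, ← parityAut_eq_neg_iff, ← h, ← map_neg, φ.injective.eq_iff]
  intro k
  ext Y
  constructor
  · rintro ⟨X, hX, rfl⟩
    exact (key k X).1 hX
  · intro hY
    exact ⟨φ.symm Y, (key k _).2 (by simpa using hY), by simp⟩

theorem IsSuperGrading.parityAut_mem [CharZero F] {G : Type*} [CommGroup G]
    {R : G → Submodule F (SuperMat n m F)} (hR : IsSuperGrading R) {g : G} {X : SuperMat n m F}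
    (hX : X ∈ R g) : parityAut n m F X ∈ R g := by
  rw [hR.parity g] at hX
  obtain ⟨Y, hY, Z, hZ, rfl⟩ := Submodule.mem_sup.1 hX
  rw [map_add, parityAut_eq_self_iff.2 hY.2, parityAut_eq_neg_iff.2 hZ.2]
  exact add_mem hY.1 (neg_mem hZ.1)

/-- An invertible matrix whose conjugation commutes with the parity automorphism is even or odd. -/
theorem parityAut_eq_or_eq_neg {T T' : SuperMat n m F} (h : T * T' = 1) (h' : T' * T = 1)
    (hT : ∀ X, parityAut n m F (T * X * T') = T * parityAut n m F X * T') :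
    parityAut n m F T = T ∨ parityAut n m F T = -T := by
  set θ := parityAut n m F with hθ
  -- Conjugation by T and by θ(T) coincide, so T⁻¹ θ(T) is central.
  obtain ⟨c, hc⟩ := exists_eq_smul_one_of_forall_commute (M := T' * θ T) fun X => by
    have h1 := hT (θ X)
    rw [map_mul, map_mul, hθ, parityAut_parityAut, ← hθ] at h1
    calc T' * θ T * X = T' * (θ T * X * θ T') * θ T := by
          rw [show T' * (θ T * X * θ T') * θ T = T' * θ T * X * (θ T' * θ T) by
            simp only [Matrix.mul_assoc], ← map_mul, h', map_one, Matrix.mul_one]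
      _ = X * (T' * θ T) := by
          rw [h1, show T' * (T * X * T') * θ T = (T' * T) * X * (T' * θ T) by
            simp only [Matrix.mul_assoc], h', Matrix.one_mul]
  have hc' : θ T = c • T := by
    have := congrArg (T * ·) hc
    simpa [← Matrix.mul_assoc, h] using this
  -- θ² = 1 forces c² = 1 unless T = 0, which can happen only for matrices of order zero.
  have h2 : (c * c) • T = T := by
    conv_rhs => rw [← parityAut_parityAut T, ← hθ, hc', map_smul, hc', smul_smul]
  by_cases hT0 : T = 0
  · left; simp [hT0]
  · have h3 : (c * c - 1) • T = 0 := by rw [sub_smul, h2, one_smul, sub_self]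
    have h4 : c * c = 1 := by
      rcases smul_eq_zero.1 h3 with h | h
      · exact sub_eq_zero.1 h
      · exact absurd h hT0
    rcases mul_self_eq_one_iff.1 h4 with rfl | rfl
    · left; simpa using hc'
    · right; simpa using hc'

end Parity

/-! ### Conjugations commuting with the transpose superinvolution -/

section Transpose

variable {F : Type*} [Field F] {n : ℕ}

/-- The standard transpose superinvolution as a linear map. -/
def trpLinear (n : ℕ) (F : Type*) [Field F] : SuperMat n n F →ₗ[F] SuperMat n n F where
  toFun := trp
  map_add' X Y := by
    ext (i | i) (j | j) <;> simp [trp, toBlocks₁₁, toBlocks₁₂, toBlocks₂₁, toBlocks₂₂, add_comm]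
  map_smul' c X := by
    ext (i | i) (j | j) <;> simp [trp, toBlocks₁₁, toBlocks₁₂, toBlocks₂₁, toBlocks₂₂]

theorem trp_fromBlocks (A B C D : Matrix (Fin n) (Fin n) F) :
    trp (fromBlocks A B C D) = fromBlocks Dᵀ (-Bᵀ) Cᵀ Aᵀ := by
  simp [trp]

theorem trp_trp (X : SuperMat n n F) : trp (trp X) = X := by
  rw [← fromBlocks_toBlocks X]
  simp [trp_fromBlocks]

theorem trp_eq (X : SuperMat n n F) :
    (swapPhi n F)⁻¹ * superTau X * swapPhi n F = trp X := by
  have : (swapPhi n F)⁻¹ = swapPhi n F :=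
    inv_eq_left_inv (by simp [swapPhi, fromBlocks_multiply])
  rw [this, ← fromBlocks_toBlocks X, trp_fromBlocks]
  simp [swapPhi, superTau, fromBlocks_transpose, fromBlocks_multiply]

/-- If conjugation by an even invertible matrix commutes with the transpose superinvolution, then
the matrix is a similitude. -/
theorem exists_trp_mul_eq_smul_of_even {A D : Matrix (Fin n) (Fin n) F} {T' : SuperMat n n F}
    (h' : T' * fromBlocks A 0 0 D = 1)
    (hT : ∀ X, trp (fromBlocks A 0 0 D * X * T') = fromBlocks A 0 0 D * trp X * T') :
    ∃ c : F, Dᵀ * A = c • 1 := by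
  set T : SuperMat n n F := fromBlocks A 0 0 D with hTdef
  -- With one factor even, `trp` reverses products without a sign.
  have hr : ∀ X, trp (X * T) = trp T * trp X := fun X => by
    rw [← fromBlocks_toBlocks X, hTdef]
    simp [trp_fromBlocks, fromBlocks_multiply]
  have hl : ∀ X, trp (T * X) = trp X * trp T := fun X => by
    rw [← fromBlocks_toBlocks X, hTdef]
    simp [trp_fromBlocks, fromBlocks_multiply]
  obtain ⟨c, hc⟩ := exists_eq_smul_one_of_forall_commute (M := trp T * T) fun X => by
    have h1 := hl (trp X)
    rw [trp_trp, show T * trp X = T * trp X * T' * T by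
      rw [Matrix.mul_assoc _ T' T, h', Matrix.mul_one], hr, hT, trp_trp] at h1
    calc trp T * T * X = trp T * (T * X * T') * T := by
          simp only [Matrix.mul_assoc, h', Matrix.mul_one]
      _ = X * (trp T * T) := by rw [h1, Matrix.mul_assoc]
  rw [hTdef, trp_fromBlocks, fromBlocks_multiply, ← fromBlocks_one, fromBlocks_smul,
    fromBlocks_inj] at hc
  exact ⟨c, by simpa using hc.1⟩

/-- Conjugation by an odd invertible matrix does not commute with the transpose
superinvolution. -/
theorem false_of_odd [CharZero F] (hn : 0 < n) {B C : Matrix (Fin n) (Fin n) F}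
    {T' : SuperMat n n F} (h : fromBlocks 0 B C 0 * T' = 1) (h' : T' * fromBlocks 0 B C 0 = 1)
    (hp : ∀ X, parityAut n n F (fromBlocks 0 B C 0 * X * T') =
      fromBlocks 0 B C 0 * parityAut n n F X * T')
    (hT : ∀ X, trp (fromBlocks 0 B C 0 * X * T') = fromBlocks 0 B C 0 * trp X * T') : False := by
  set T : SuperMat n n F := fromBlocks 0 B C 0 with hTdef
  -- With T odd, the sign in the product rule is that of the other factor's parity, so `parityAut`
  -- absorbs it.
  have hr : ∀ X, trp (X * T) = trp T * trp (parityAut n n F X) := fun X => by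
    rw [← fromBlocks_toBlocks X, hTdef]
    simp [trp_fromBlocks, fromBlocks_multiply]
  have hl : ∀ X, trp (T * X) = trp (parityAut n n F X) * trp T := fun X => by
    rw [← fromBlocks_toBlocks X, hTdef]
    simp [trp_fromBlocks, fromBlocks_multiply]
  obtain ⟨c, hc⟩ := exists_eq_smul_one_of_forall_commute (M := trp T * T) fun X => by
    have h1 := hl (parityAut n n F (trp X))
    rw [parityAut_parityAut, trp_trp,
      show T * parityAut n n F (trp X) = T * parityAut n n F (trp X) * T' * T by
      rw [Matrix.mul_assoc _ T' T, h', Matrix.mul_one], hr, hp, parityAut_parityAut, hT,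
      trp_trp] at h1
    calc trp T * T * X = trp T * (T * X * T') * T := by
          simp only [Matrix.mul_assoc, h', Matrix.mul_one]
      _ = X * (trp T * T) := by rw [h1, Matrix.mul_assoc]
  rw [hTdef, trp_fromBlocks, fromBlocks_multiply, ← fromBlocks_one, fromBlocks_smul,
    fromBlocks_inj] at hc
  -- The two diagonal blocks of `trp T * T` give BᵀC = -c and, after transposing, BᵀC = c. So BᵀC =
  -- 0, although B and C have right inverses because T does.
  have h1 : -(Bᵀ * C) = c • 1 := by simpa using hc.1
  have h2 : Cᵀ * B = c • 1 := by simpa using hc.2.2.2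
  have h3 : Bᵀ * C = c • 1 := by
    have := congrArg transpose h2
    simpa [transpose_mul] using this
  have h4 : Bᵀ * C = 0 := Matrix.eq_zero_of_neg_eq_self (h1.trans h3.symm)
  have h5 : C * T'.toBlocks₁₂ = 1 := by
    rw [← fromBlocks_toBlocks T', hTdef, fromBlocks_multiply, ← fromBlocks_one,
      fromBlocks_inj] at h
    simpa using h.2.2.2
  have h6 : B = 0 := by
    have := congrArg (fun M => (M * T'.toBlocks₁₂)ᵀ) h4
    simpa [Matrix.mul_assoc, h5] using this
  have h7 : B * T'.toBlocks₂₁ = 1 := by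
    rw [← fromBlocks_toBlocks T', hTdef, fromBlocks_multiply, ← fromBlocks_one,
      fromBlocks_inj] at h
    simpa using h.1
  have := congrFun (congrFun h7 ⟨0, hn⟩) ⟨0, hn⟩
  simp [h6] at this

end Transpose

/-! ### Arranging the degrees in blocks -/

/-- Up to a permutation, an `n`-tuple `h` and the tuple `g₀ h⁻¹` are simultaneously block tuples,
whose entries are matched by a permutation of the indices. -/
theorem exists_isBlockTuple {G : Type*} [CommGroup G] {n : ℕ} (h : Fin n → G) (g₀ : G) :
    ∃ (r : ℕ) (g : Fin r → G) (p q : Fin r → ℕ) (i : Equiv.Perm (Fin r)) (σ : Equiv.Perm (Fin n)),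
      Function.Injective g ∧ (∀ k, 0 < p k + q k) ∧ ∑ k, p k = n ∧ ∑ k, q k = n ∧
      IsBlockTuple (fun a => h (σ a)) g p ∧
      IsBlockTuple (fun a => g₀ * (h (σ a))⁻¹) (fun k => g (i k)) (fun k => q (i k)) ∧
      ∀ k, g k * g (i k) = g₀ := by
  classical
  -- All degrees that occur on either side; x ↦ g₀ x⁻¹ is an involution of this set and yields the
  -- permutation `i`.
  let S : Finset G := Finset.univ.image h ∪ Finset.univ.image fun a => g₀ * (h a)⁻¹
  have hS : ∀ a, h a ∈ S := fun a => by simp [S]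
  have hinv : ∀ x ∈ S, g₀ * x⁻¹ ∈ S := by
    intro x hx
    rcases Finset.mem_union.1 hx with hx | hx
    · obtain ⟨a, -, rfl⟩ := Finset.mem_image.1 hx
      simp [S]
    · obtain ⟨a, -, rfl⟩ := Finset.mem_image.1 hx
      simp [S]
  let ι : S → S := fun x => ⟨g₀ * (x : G)⁻¹, hinv x x.2⟩
  have hι : Function.Involutive ι := fun x => Subtype.ext (by simp [ι])
  let e : S ≃ Fin S.card := S.equivFin
  let g : Fin S.card → G := fun k => (e.symm k : G)
  let i : Equiv.Perm (Fin S.card) := (e.symm.trans hι.toPerm).trans e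
  have hgi : ∀ k, g (i k) = g₀ * (g k)⁻¹ := fun k => by simp [g, i, ι]
  let f : Fin n → Fin S.card := fun a => e ⟨h a, hS a⟩
  have hgf : ∀ a, g (f a) = h a := fun a => by simp [g, f]
  have hg : Function.Injective g := fun k l hkl => e.symm.injective (Subtype.ext hkl)
  let σ := Tuple.sort f
  have hmono : Monotone (fun a => f (σ a)) := Tuple.monotone_sort f
  let p : Fin S.card → ℕ := fun k => (Finset.univ.filter fun a => f (σ a) = k).card
  have hp : ∀ a, 0 < p (f a) := fun a =>
    Finset.card_pos.2 ⟨σ.symm a, by simp⟩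
  have hsum : ∑ k, p k = n := by
    have := Finset.card_eq_sum_card_fiberwise (s := (Finset.univ : Finset (Fin n)))
      (t := (Finset.univ : Finset (Fin S.card))) (f := fun a => f (σ a)) (by simp)
    simpa using this.symm
  -- The choice q = p ∘ i⁻¹ makes q (i k) = p k: the odd degree paired with g k occurs as often as g
  -- k does among the even ones.
  refine ⟨S.card, g, p, fun k => p (i.symm k), i, σ, hg, ?_, hsum, ?_, ?_, ?_, ?_⟩
  · intro k
    rcases Finset.mem_union.1 (e.symm k).2 with hk | hk
    · obtain ⟨a, -, ha⟩ := Finset.mem_image.1 hk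
      have : f a = k := hg ((hgf a).trans ha)
      exact Nat.add_pos_left (this ▸ hp a) _
    · obtain ⟨a, -, ha⟩ := Finset.mem_image.1 hk
      have : i (f a) = k := hg (by rw [hgi, hgf]; exact ha)
      refine Nat.add_pos_right _ ?_
      simpa [← this] using hp a
  · rw [Equiv.sum_comp i.symm p, hsum]
  · simpa only [hgf] using isBlockTuple_comp hmono g
  · simpa only [hgf, hgi, Equiv.symm_apply_apply] using isBlockTuple_comp hmono fun k => g (i k)
  · intro k
    rw [hgi, mul_inv_cancel_comm_assoc]

/-! ### Simultaneous diagonalization of the character action -/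

section Core

variable {F G : Type*} [Field F] [CommGroup G] {n : ℕ}

/-- Diagonal images of the character matrices under an automorphism are given by entries of the
tuple. -/
theorem exists_eq_char_of_map_eq_diagonal {ι : Type*} [Fintype ι] [DecidableEq ι] {t : ι → G}
    (ω : Matrix ι ι F ≃ₐ[F] Matrix ι ι F) {μ : (G →* Fˣ) → ι → F}
    (h : ∀ χ, ω (charDiag χ t) = diagonal (μ χ)) (i : ι) :
    ∃ a, ∀ χ : G →* Fˣ, μ χ i = χ (t a) := by
  obtain ⟨Q, Q', hQ, hQ', hω⟩ := exists_conj_of_algEquiv ω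
  -- Column i of Q' is a common eigenvector of the matrices `charDiag χ t`. A nonzero entry a
  -- identifies its eigenvalue, with a independent of χ.
  obtain ⟨a, ha⟩ : ∃ a, Q' a i ≠ 0 := by
    by_contra! hcon
    have := congrFun (congrFun hQ i) i
    rw [Matrix.mul_apply, Finset.sum_eq_zero fun a _ => by rw [hcon, mul_zero]] at this
    simp at this
  refine ⟨a, fun χ => ?_⟩
  have h1 : Q' * diagonal (μ χ) = charDiag χ t * Q' := by
    rw [← h, hω, ← Matrix.mul_assoc, ← Matrix.mul_assoc, hQ', Matrix.one_mul]
  have h2 := congrFun (congrFun h1 a) i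
  rw [charDiag, mul_diagonal, diagonal_mul, mul_comm] at h2
  exact mul_right_cancel₀ ha h2

/-- An invertible matrix of order `n` defines an automorphism of the superalgebra `M_{n,n}(F)`
commuting with the standard transpose superinvolution. -/
theorem exists_isSuperAut_trp [CharZero F] {U V : Matrix (Fin n) (Fin n) F} (h : U * V = 1)
    (h' : V * U = 1) :
    ∃ ψ : SuperMat n n F ≃ₐ[F] SuperMat n n F, IsSuperAut ψ ∧ (∀ X, ψ (trp X) = trp (ψ X)) ∧
      ∀ A D, ψ (fromBlocks A 0 0 D) = fromBlocks (V * A * U) 0 0 (Uᵀ * D * Vᵀ) := by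
  have ht : Uᵀ * Vᵀ = 1 := by rw [← transpose_mul, h', transpose_one]
  have ht' : Vᵀ * Uᵀ = 1 := by rw [← transpose_mul, h, transpose_one]
  let ψ : SuperMat n n F ≃ₐ[F] SuperMat n n F :=
    conjEquiv (fromBlocks V 0 0 Uᵀ) (fromBlocks U 0 0 Vᵀ)
      (by simp [fromBlocks_multiply, h', ht]) (by simp [fromBlocks_multiply, h, ht'])
  have hψ : ∀ A B C D, ψ (fromBlocks A B C D) =
      fromBlocks (V * A * U) (V * B * Vᵀ) (Uᵀ * C * U) (Uᵀ * D * Vᵀ) := fun A B C D => by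
    simp [ψ, conjEquiv_apply, fromBlocks_multiply]
  refine ⟨ψ, isSuperAut_of_apply_parityAut fun X => ?_, fun X => ?_, fun A D => ?_⟩
  · rw [← fromBlocks_toBlocks X]
    simp [hψ]
  · rw [← fromBlocks_toBlocks X]
    simp [hψ, trp_fromBlocks, Matrix.mul_assoc]
  · simp [hψ]

/-- The matrix of a character for a graded transpose superinvolution is an even similitude. -/
theorem exists_map_charDiag_eq_fromBlocks [CharZero F] (hn : 0 < n) {t : Fin n ⊕ Fin n → G}
    (ω : SuperMat n n F ≃ₐ[F] SuperMat n n F)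
    (hθ : ∀ g, ∀ X ∈ (elementaryComp F t g).map ω.toLinearMap,
      parityAut n n F X ∈ (elementaryComp F t g).map ω.toLinearMap)
    (htrp : ∀ g, ∀ X ∈ (elementaryComp F t g).map ω.toLinearMap,
      trp X ∈ (elementaryComp F t g).map ω.toLinearMap) (χ : G →* Fˣ) :
    ∃ (A D : Matrix (Fin n) (Fin n) F) (c : F),
      ω (charDiag χ t) = fromBlocks A 0 0 D ∧ Dᵀ * A = c • 1 := by
  have hp := map_char_conj ω (parityAut n n F).toLinearMap hθ χ
  have hs := map_char_conj ω (trpLinear n F) htrp χ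
  have h : ω (charDiag χ t) * ω (charDiag χ⁻¹ t) = 1 := by
    rw [← map_mul, charDiag_mul_inv, map_one]
  have h' : ω (charDiag χ⁻¹ t) * ω (charDiag χ t) = 1 := by
    rw [← map_mul, charDiag_inv_mul, map_one]
  generalize ω (charDiag χ t) = T at *
  generalize ω (charDiag χ⁻¹ t) = T' at *
  rcases parityAut_eq_or_eq_neg h h' hp with hT | hT
  · obtain ⟨h12, h21⟩ := mem_superComp_zero.1 (parityAut_eq_self_iff.1 hT)
    have hTb : T = fromBlocks T.toBlocks₁₁ 0 0 T.toBlocks₂₂ := by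
      conv_lhs => rw [← fromBlocks_toBlocks T, h12, h21]
    rw [hTb] at h' hs
    obtain ⟨c, hc⟩ := exists_trp_mul_eq_smul_of_even h' hs
    exact ⟨_, _, c, hTb, hc⟩
  · obtain ⟨h11, h22⟩ := mem_superComp_one.1 (parityAut_eq_neg_iff.1 hT)
    have hTb : T = fromBlocks 0 T.toBlocks₁₂ T.toBlocks₂₁ 0 := by
      conv_lhs => rw [← fromBlocks_toBlocks T, h11, h22]
    rw [hTb] at h h' hs hp
    exact (false_of_odd hn h h' hp hs).elim

/-- A graded transpose superinvolution admits a homogeneous basis adapted to it: the degrees of the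
even basis vectors may be permuted, those of the odd ones are determined by them. -/
theorem exists_adapted_automorphism [IsAlgClosed F] [CharZero F] [Finite G] (hn : 0 < n)
    {t : Fin n ⊕ Fin n → G} (ω : SuperMat n n F ≃ₐ[F] SuperMat n n F)
    (hθ : ∀ g, ∀ X ∈ (elementaryComp F t g).map ω.toLinearMap,
      parityAut n n F X ∈ (elementaryComp F t g).map ω.toLinearMap)
    (htrp : ∀ g, ∀ X ∈ (elementaryComp F t g).map ω.toLinearMap,
      trp X ∈ (elementaryComp F t g).map ω.toLinearMap) :
    ∃ (h : Fin n → G) (g₀ : G), ∀ σ : Equiv.Perm (Fin n),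
      ∃ ψ : SuperMat n n F ≃ₐ[F] SuperMat n n F, IsSuperAut ψ ∧ (∀ X, ψ (trp X) = trp (ψ X)) ∧
        ∀ χ : G →* Fˣ, ψ (ω (charDiag χ t)) =
          charDiag χ (Sum.elim (fun a => h (σ a)) fun a => g₀ * (h (σ a))⁻¹) := by
  choose A D lam hT hDA using exists_map_charDiag_eq_fromBlocks hn ω hθ htrp
  obtain ⟨Q, Q', hQ, hQ', hω⟩ := exists_conj_of_algEquiv ω
  -- The upper n rows of Q have a right inverse, so n of their columns form a basis. By `hAQ` these
  -- are common eigenvectors of all A χ.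
  have hM : Q.submatrix Sum.inl id * Q'.submatrix id Sum.inl = 1 := by
    rw [← submatrix_mul _ _ _ _ _ Function.bijective_id, hQ,
      submatrix_one _ Sum.inl_injective]
  obtain ⟨c, hc⟩ := exists_isUnit_submatrix_of_mul_eq_one hM
  have hAQ : ∀ χ : G →* Fˣ, A χ * Q.submatrix Sum.inl id = Q.submatrix Sum.inl id * charDiag χ t := by
    intro χ
    have h1 : fromBlocks (A χ) 0 0 (D χ) * Q = Q * charDiag χ t := by
      rw [← hT, hω, Matrix.mul_assoc, hQ', Matrix.mul_one]
    ext i a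
    have h2 := congrFun (congrFun h1 (Sum.inl i)) a
    rw [charDiag, mul_diagonal, Matrix.mul_apply, Fintype.sum_sum_type] at h2
    rw [charDiag, mul_diagonal, Matrix.mul_apply]
    simpa using h2
  -- The selection `d` is left arbitrary because it is used twice: with `c` to recognize `lam` as
  -- evaluation at a group element, then with `c ∘ σ` for the reordered basis.
  have key : ∀ d : Fin n → Fin n ⊕ Fin n, IsUnit (Q.submatrix Sum.inl d) →
      ∃ ψ : SuperMat n n F ≃ₐ[F] SuperMat n n F, IsSuperAut ψ ∧ (∀ X, ψ (trp X) = trp (ψ X)) ∧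
        ∀ χ : G →* Fˣ, ψ (ω (charDiag χ t)) = diagonal (Sum.elim (fun a => (χ (t (d a)) : F))
          fun a => lam χ * (χ (t (d a)) : F)⁻¹) := by
    intro d hd
    obtain ⟨V, hUV, hVU⟩ := isUnit_iff_exists.1 hd
    set U := Q.submatrix Sum.inl d with hU
    obtain ⟨ψ, hψ, hψt, hψb⟩ := exists_isSuperAut_trp hUV hVU
    refine ⟨ψ, hψ, hψt, fun χ => ?_⟩
    have hAU : A χ * U = U * diagonal fun a => (χ (t (d a)) : F) := by
      ext i a
      have := congrFun (congrFun (hAQ χ) i) (d a)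
      rw [charDiag, mul_diagonal, Matrix.mul_apply] at this
      rw [mul_diagonal, Matrix.mul_apply]
      exact this
    have h1 : V * A χ * U = diagonal fun a => (χ (t (d a)) : F) := by
      rw [Matrix.mul_assoc, hAU, ← Matrix.mul_assoc, hVU, Matrix.one_mul]
    have h2 : V * (D χ)ᵀ * U = diagonal fun a => lam χ * (χ (t (d a)) : F)⁻¹ := by
      have h3 : V * (D χ)ᵀ * U * (V * A χ * U) = lam χ • 1 := by
        rw [show V * (D χ)ᵀ * U * (V * A χ * U) = V * ((D χ)ᵀ * ((U * V) * A χ)) * U by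
          simp only [Matrix.mul_assoc], hUV, Matrix.one_mul, hDA]
        simp [hVU]
      have h4 : (diagonal fun a => (χ (t (d a)) : F)) *
          (diagonal fun a => (χ (t (d a)) : F)⁻¹) = 1 := by simp
      calc V * (D χ)ᵀ * U = V * (D χ)ᵀ * U * (V * A χ * U) *
            (diagonal fun a => (χ (t (d a)) : F)⁻¹) := by
            rw [h1, Matrix.mul_assoc _ (diagonal _), h4, Matrix.mul_one]
        _ = _ := by
            rw [h3, smul_mul_assoc, Matrix.one_mul, ← diagonal_smul]
            rfl
    rw [hT, hψb, h1, ← fromBlocks_diagonal]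
    congr 1
    rw [← diagonal_transpose, ← h2]
    simp only [transpose_mul, transpose_transpose, Matrix.mul_assoc]
  -- The first odd diagonal entry, lam χ · χ(t (c 0))⁻¹, must equal χ(t a) for one a valid for all
  -- χ. This gives g₀ = t a · t (c 0).
  obtain ⟨ψ₀, -, -, hψ₀⟩ := key c hc
  obtain ⟨a, ha⟩ := exists_eq_char_of_map_eq_diagonal (ω.trans ψ₀) hψ₀ (Sum.inr ⟨0, hn⟩)
  have hlam : ∀ χ : G →* Fˣ, lam χ = χ (t a * t (c ⟨0, hn⟩)) := fun χ => by
    have := ha χ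
    rw [Sum.elim_inr, mul_inv_eq_iff_eq_mul₀ (Units.ne_zero _)] at this
    rw [this, map_mul, Units.val_mul]
  refine ⟨fun k => t (c k), t a * t (c ⟨0, hn⟩), fun σ => ?_⟩
  have hcσ : IsUnit (Q.submatrix Sum.inl fun k => c (σ k)) := by
    have : (Q.submatrix Sum.inl fun k => c (σ k)) =
        ((Q.submatrix Sum.inl id).submatrix id c).submatrix (Equiv.refl _) σ := rfl
    rw [this, isUnit_submatrix_equiv]
    exact hc
  obtain ⟨ψ, hψ, hψt, hψd⟩ := key _ hcσ
  refine ⟨ψ, hψ, hψt, fun χ => ?_⟩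
  rw [hψd, charDiag]
  congr 1
  ext (k | k)
  · rfl
  · simp [hlam]

end Core

/-! ### Symmetric and skew elements, and the main theorem -/

theorem trp_eq_neg_iff {F : Type*} [Field F] {n : ℕ} {Y : SuperMat n n F} :
    trp Y = -Y ↔ ∃ A B C : Matrix (Fin n) (Fin n) F,
      Bᵀ = B ∧ Cᵀ = -C ∧ Y = fromBlocks A B C (-Aᵀ) := by
  constructor
  · intro h
    rw [← fromBlocks_toBlocks Y, trp_fromBlocks, fromBlocks_neg, fromBlocks_inj] at h
    refine ⟨Y.toBlocks₁₁, Y.toBlocks₁₂, Y.toBlocks₂₁, neg_injective h.2.1, h.2.2.1, ?_⟩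
    conv_lhs => rw [← fromBlocks_toBlocks Y]
    rw [h.2.2.2, neg_neg]
  · rintro ⟨A, B, C, hB, hC, rfl⟩
    rw [trp_fromBlocks, fromBlocks_neg, hB, hC]
    simp

theorem trp_eq_self_iff {F : Type*} [Field F] {n : ℕ} {Y : SuperMat n n F} :
    trp Y = Y ↔ ∃ A B C : Matrix (Fin n) (Fin n) F,
      Bᵀ = -B ∧ Cᵀ = C ∧ Y = fromBlocks A B C Aᵀ := by
  constructor
  · intro h
    rw [← fromBlocks_toBlocks Y, trp_fromBlocks, fromBlocks_inj] at h
    refine ⟨Y.toBlocks₁₁, Y.toBlocks₁₂, Y.toBlocks₂₁, neg_eq_iff_eq_neg.1 h.2.1, h.2.2.1, ?_⟩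
    conv_lhs => rw [← fromBlocks_toBlocks Y]
    rw [h.2.2.2]
  · rintro ⟨A, B, C, hB, hC, rfl⟩
    rw [trp_fromBlocks, hB, hC]
    simp

theorem theorem5p3 {F G : Type*} [Field F] [IsAlgClosed F] [CharZero F] [CommGroup G] [Finite G]
    (n : ℕ) (hn : 0 < n)
    (R : G → Submodule F (SuperMat n n F)) (hR : IsSuperGrading R) (hel : IsElementary R)
    (s : SuperMat n n F →ₗ[F] SuperMat n n F) (hs : IsSuperinvolution s)
    (hsR : RespectsGrading s R) (htr : IsTransposeType s) :
    ∃ (r : ℕ) (g : Fin r → G) (p q : Fin r → ℕ) (i : Equiv.Perm (Fin r))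
      (t : Fin n ⊕ Fin n → G) (φ : SuperMat n n F ≃ₐ[F] SuperMat n n F),
      -- the tuple `(g_1^{(p_1)}, …, g_r^{(p_r)}, g_{i_1}^{(q_{i_1})}, …, g_{i_r}^{(q_{i_r})})`
      Function.Injective g ∧ (∀ k, 0 < p k + q k) ∧
      ∑ k, p k = n ∧ ∑ k, q k = n ∧
      IsBlockTuple (fun a => t (Sum.inl a)) g p ∧
      IsBlockTuple (fun a => t (Sum.inr a)) (fun k => g (i k)) (fun k => q (i k)) ∧
      (∀ k l, g k * g (i k) = g l * g (i l)) ∧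
      -- `φ` is an isomorphism of graded superalgebras with superinvolution
      IsSuperAut φ ∧
      (∀ d, (R d).map φ.toLinearMap = elementaryComp F t d) ∧
      (∀ X, φ (s X) = (swapPhi n F)⁻¹ * superTau (φ X) * swapPhi n F) ∧
      -- the skew-symmetric and the symmetric elements
      φ '' skewElements s =
        {Y | ∃ A B C : Matrix (Fin n) (Fin n) F, Bᵀ = B ∧ Cᵀ = -C ∧ Y = fromBlocks A B C (-Aᵀ)} ∧
      φ '' symmElements s =
        {Y | ∃ A B C : Matrix (Fin n) (Fin n) F, Bᵀ = -B ∧ Cᵀ = C ∧ Y = fromBlocks A B C Aᵀ} := by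
  obtain ⟨t, ψ, hψ⟩ := hel
  obtain ⟨ψ₁, hψ₁, hψ₁s⟩ := htr
  -- Transporting by ψ₁ turns `s` into `trp`; the transported grading is elementary for the matrix
  -- units given by ψ followed by ψ₁.
  have hmap : ∀ g, (elementaryComp F t g).map (ψ.trans ψ₁).toLinearMap =
      (R g).map ψ₁.toLinearMap := fun g => by
    rw [hψ, ← Submodule.map_comp]
    rfl
  have hθ : ∀ g, ∀ X ∈ (elementaryComp F t g).map (ψ.trans ψ₁).toLinearMap,
      parityAut n n F X ∈ (elementaryComp F t g).map (ψ.trans ψ₁).toLinearMap := by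
    intro g X hX
    rw [hmap] at hX ⊢
    obtain ⟨Y, hY, rfl⟩ := hX
    exact ⟨_, hR.parityAut_mem hY, hψ₁.apply_parityAut Y⟩
  have htrp : ∀ g, ∀ X ∈ (elementaryComp F t g).map (ψ.trans ψ₁).toLinearMap,
      trp X ∈ (elementaryComp F t g).map (ψ.trans ψ₁).toLinearMap := by
    intro g X hX
    rw [hmap] at hX ⊢
    obtain ⟨Y, hY, rfl⟩ := hX
    exact ⟨s Y, hsR g ▸ Submodule.mem_map_of_mem hY, hψ₁s Y⟩
  obtain ⟨h, g₀, hcore⟩ := exists_adapted_automorphism hn (ψ.trans ψ₁) hθ htrp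
  obtain ⟨r, g, p, q, i, σ, hg, hpq, hp, hq, hb, hb', hgi⟩ := exists_isBlockTuple h g₀
  obtain ⟨ψ₂, hψ₂, hψ₂t, hψ₂d⟩ := hcore σ
  have hφs : ∀ X, (ψ₁.trans ψ₂) (s X) = trp ((ψ₁.trans ψ₂) X) := fun X => by
    rw [AlgEquiv.trans_apply, hψ₁s, hψ₂t, AlgEquiv.trans_apply]
  refine ⟨r, g, p, q, i, Sum.elim (fun a => h (σ a)) fun a => g₀ * (h (σ a))⁻¹, ψ₁.trans ψ₂,
    hg, hpq, hp, hq, hb, hb', fun k l => by rw [hgi, hgi], ?_, ?_, ?_, ?_, ?_⟩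
  · refine isSuperAut_of_apply_parityAut fun X => ?_
    rw [AlgEquiv.trans_apply, hψ₁.apply_parityAut, hψ₂.apply_parityAut, AlgEquiv.trans_apply]
  · intro d
    rw [← map_elementaryComp ((ψ.trans ψ₁).trans ψ₂) hψ₂d d, hψ, ← Submodule.map_comp]
    rfl
  · intro X
    rw [trp_eq, hφs]
  · ext Y
    rw [Set.mem_ofPred_eq, ← trp_eq_neg_iff]
    obtain ⟨X, rfl⟩ := (ψ₁.trans ψ₂).surjective Y
    rw [(ψ₁.trans ψ₂).injective.mem_set_image, skewElements, Set.mem_ofPred_eq, ← hφs, ← map_neg,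
      (ψ₁.trans ψ₂).injective.eq_iff]
  · ext Y
    rw [Set.mem_ofPred_eq, ← trp_eq_self_iff]
    obtain ⟨X, rfl⟩ := (ψ₁.trans ψ₂).surjective Y
    rw [(ψ₁.trans ψ₂).injective.mem_set_image, symmElements, Set.mem_ofPred_eq, ← hφs,
      (ψ₁.trans ψ₂).injective.eq_iff]
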